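/- **Setting.** A multi-player multi-armed bandit (MPMAB) instance has $M\ge 1$ players and $K\ge 1$ arms; each player $p\in[M]$ and arm $i\in[K]$ has a reward distribution $\mathcal D_i^p$ on $[0,1]$ with mean $\mu_i^p$. It is an $\epsilon$-MPMAB instance, $\epsilon\in[0,1]$, if $|\mu_i^p-\mu_i^q|\le\epsilon$ for all $p,q\in[M]$ and $i\in[K]$. Let $\Delta_i^p=\max_{j}\mu_j^p-\mu_i^p$, $\mathcal I_\epsilon=\{i\in[K]:\exists p\in[M],\ \Delta_i^p>5\epsilon\}$ and $\mathcal I_\epsilon^C=[K]\setminus\mathcal I_\epsilon$. Let $T>\max(M,K)$ be the horizon. In each round $t\in[T]$ every player $p$ pulls an arm $i_t^p$, chosen as a (possibly randomized) function of the arms and rewards of all players in rounds $1,\dots,t-1$; then, given the arms pulled, the rewards $r_t^p\sim\mathcal D^p_{i_t^p}$ are drawn independently, and all arms and rewards are revealed to all players. With $n_i^p(T)$ the number of pulls of arm $i$ by player $p$ in the $T$ rounds, the expected collective regret is $\mathbb E[\mathcal R(T)]=\sum_{p\in[M]}\sum_{i\in[K]}\Delta_i^p\,\mathbb E[n_i^p(T)]$.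 **Algorithm RobustAgg($\epsilon$).** In round $t$, let $n_i^p$ be the number of pulls of arm $i$ by player $p$ in rounds $s<t$, $m_i^p=\sum_{q\ne p}n_i^q$, $\overline{n_i^p}=\max(1,n_i^p)$, $\overline{m_i^p}=\max(1,m_i^p)$, and $$\zeta_i^p=\frac1{\overline{n_i^p}}\sum_{s<t,\,i_s^p=i}r_s^p,\qquad \eta_i^p=\frac1{\overline{m_i^p}}\sum_{q\neq p}\ \sum_{s<t,\,i_s^q=i}r_s^q,$$ $$F_i^p(\lambda)=8\sqrt{13\ln T\Big[\frac{\lambda^2}{\overline{n_i^p}}+\frac{(1-\lambda)^2}{\overline{m_i^p}}\Big]}+(1-\lambda)\epsilon .$$ With $\lambda^*=\lambda^*(p,i)$ the minimizer of $F_i^p$ over $[0,1]$, put $\mathrm{UCB}_i^p=\lambda^*\zeta_i^p+(1-\lambda^*)\eta_i^p+F_i^p(\lambda^*)$. Each player $p$ pulls an arm that maximizes $\mathrm{UCB}_i^p$ over $i\in[K]$, ties being broken in any way. **Theorem.** There are absolute constants $C>0$ and $k\in\mathbb N$ such that for all $M,K\ge1$, all $T>\max(M,K)$, all $\epsilon\in[0,1]$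 and all $\epsilon$-MPMAB instances with $M$ players and $K$ arms, RobustAgg($\epsilon$) run for $T$ rounds satisfies $$\mathbb E[\mathcal R(T)]\le C(\ln T)^k\Big(\sqrt{|\mathcal I_\epsilon|MT}+M\sqrt{(|\mathcal I_\epsilon^C|-1)T}+M|\mathcal I_\epsilon|\Big).$$ In particular the bound does not depend on the gaps $\Delta_i^p$. -/

import Mathlib

open MeasureTheory ProbabilityTheory

namespace MPMAB

noncomputable section

/-- A multi-player multi-armed bandit instance with `M` players and `K` arms: player `p` and arm `i`
carry a reward distribution, a probability measure on the real line concentrated on `[0, 1]`. -/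
structure Instance (M K : ℕ) where
  reward : Fin M → Fin K → Measure ℝ
  isProb : ∀ p i, IsProbabilityMeasure (reward p i)
  supp : ∀ p i, reward p i (Set.Icc (0 : ℝ) 1)ᶜ = 0

variable {M K : ℕ}

/-- Mean reward of arm `i` for player `p`. -/
def Instance.mean (ν : Instance M K) (p : Fin M) (i : Fin K) : ℝ := ∫ x, x ∂(ν.reward p i)

/-- Optimal mean reward of player `p` (a maximum over the finitely many arms). -/
def Instance.optMean (ν : Instance M K) (p : Fin M) : ℝ := ⨆ i, ν.mean p i

/-- Suboptimality gap of arm `i` for player `p`. -/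
def Instance.gap (ν : Instance M K) (p : Fin M) (i : Fin K) : ℝ := ν.optMean p - ν.mean p i

/-- The instance has dissimilarity parameter `ε`, where `ε ∈ [0, 1]`. -/
def Instance.IsDissimilar (ν : Instance M K) (ε : ℝ) : Prop :=
  ε ∈ Set.Icc (0 : ℝ) 1 ∧ ∀ (p q : Fin M) (i : Fin K), |ν.mean p i - ν.mean q i| ≤ ε

open Classical in
/-- The set of subpar arms: those with gap larger than `5 ε` for some player. -/
def Instance.subpar (ν : Instance M K) (ε : ℝ) : Finset (Fin K) :=
  Finset.univ.filter fun i => ∃ p : Fin M, 5 * ε < ν.gap p i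

/-- The history of the first `t` rounds: for each round and each player, the arm pulled and the
reward received. -/
abbrev History (M K t : ℕ) : Type := Fin t → Fin M → Fin K × ℝ

/-- A multi-player bandit algorithm: for each `t`, a conditional distribution of the arms pulled by
all the players in the round that follows the first `t` rounds, given the history of these. (With a
horizon `T`, only the policies with `t < T` play a role.) -/
structure Algorithm (M K : ℕ) where
  policy : ∀ t : ℕ, Kernel (History M K t) (Fin M → Fin K)
  isMarkov : ∀ t, IsMarkovKernel (policy t)

/-- Given the arms `a` pulled by the players in a round, the law of the (arm, reward) pairs of that
round: the rewards are drawn independently, that of player `p` from its distribution for arm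
`a p`. -/
def rewardKernel (ν : Instance M K) : Kernel (Fin M → Fin K) (Fin M → Fin K × ℝ) :=
  Kernel.ofFunOfCountable fun a =>
    Measure.pi fun p => (ν.reward p (a p)).map fun r => (a p, r)

/-- The law of the history of the first `t` rounds when the algorithm interacts with the
instance. -/
def historyLaw (ν : Instance M K) (A : Algorithm M K) : (t : ℕ) → Measure (History M K t)
  | 0 => Measure.dirac (fun s => Fin.elim0 s)
  | t + 1 => ((historyLaw ν A t) ⊗ₘ (rewardKernel ν ∘ₖ A.policy t)).map
      fun x => (Fin.snoc x.1 x.2 : History M K (t + 1))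

/-- Number of pulls of arm `i` by player `p` in a history. -/
def pulls {t : ℕ} (h : History M K t) (p : Fin M) (i : Fin K) : ℕ :=
  (Finset.univ.filter fun s : Fin t => (h s p).1 = i).card

/-- Sum of the rewards that player `p` received from arm `i` in a history. -/
def rewardSum {t : ℕ} (h : History M K t) (p : Fin M) (i : Fin K) : ℝ :=
  ∑ s : Fin t, if (h s p).1 = i then (h s p).2 else 0

/-- Number of pulls of arm `i` by the players other than `p`. -/
def othersPulls {t : ℕ} (h : History M K t) (p : Fin M) (i : Fin K) : ℕ :=
  ∑ q ∈ Finset.univ.erase p, pulls h q i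

/-- Number of pulls of arm `i` by player `p`, replaced by `1` if it is `0`. -/
def nBar {t : ℕ} (h : History M K t) (p : Fin M) (i : Fin K) : ℕ := max 1 (pulls h p i)

/-- Number of pulls of arm `i` by the players other than `p`, replaced by `1` if it is `0`. -/
def mBar {t : ℕ} (h : History M K t) (p : Fin M) (i : Fin K) : ℕ := max 1 (othersPulls h p i)

/-- Empirical mean reward of arm `i` from the samples of player `p`. -/
def zeta {t : ℕ} (h : History M K t) (p : Fin M) (i : Fin K) : ℝ :=
  1 / (nBar h p i : ℝ) * rewardSum h p i

/-- Empirical mean reward of arm `i` from the samples of the players other than `p`. -/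
def eta {t : ℕ} (h : History M K t) (p : Fin M) (i : Fin K) : ℝ :=
  1 / (mBar h p i : ℝ) * ∑ q ∈ Finset.univ.erase p, rewardSum h q i

/-- The weighted estimate of the mean reward. -/
def kappa {t : ℕ} (h : History M K t) (p : Fin M) (i : Fin K) (lam : ℝ) : ℝ :=
  lam * zeta h p i + (1 - lam) * eta h p i

/-- Width of the confidence interval with weight `lam`, for horizon `T` and (positive) sample
sizes `n` and `m`. -/
def width (T : ℕ) (ε : ℝ) (n m : ℕ) (lam : ℝ) : ℝ :=
  8 * Real.sqrt (13 * Real.log T * (lam ^ 2 / (n : ℝ) + (1 - lam) ^ 2 / (m : ℝ))) + (1 - lam) * ε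

theorem exists_isMinOn_width (T : ℕ) (ε : ℝ) (n m : ℕ) :
    ∃ lam ∈ Set.Icc (0 : ℝ) 1, IsMinOn (width T ε n m) (Set.Icc (0 : ℝ) 1) lam := by
  refine isCompact_Icc.exists_isMinOn ⟨0, by simp⟩ (Continuous.continuousOn ?_)
  unfold width
  fun_prop

/-- The weight in `[0, 1]` that minimizes the width of the confidence interval. -/
def lamStar (T : ℕ) (ε : ℝ) (n m : ℕ) : ℝ := (exists_isMinOn_width T ε n m).choose

/-- The upper confidence bound on the mean reward of arm `i` for player `p`. -/
def ucb (T : ℕ) (ε : ℝ) {t : ℕ} (h : History M K t) (p : Fin M) (i : Fin K) : ℝ :=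
  kappa h p i (lamStar T ε (nBar h p i) (mBar h p i)) +
    width T ε (nBar h p i) (mBar h p i) (lamStar T ε (nBar h p i) (mBar h p i))

/-- The algorithm is RobustAgg(`ε`) with horizon `T`: in each of the `T` rounds every player pulls
an arm that maximizes its upper confidence bound. Ties may be broken in any way. -/
def Algorithm.IsRobustAgg (A : Algorithm M K) (T : ℕ) (ε : ℝ) : Prop :=
  ∀ t < T, ∀ h : History M K t, ∀ᵐ a ∂(A.policy t h),
    ∀ (p : Fin M) (i : Fin K), ucb T ε h p i ≤ ucb T ε h p (a p)

/-- The expected collective regret of an algorithm on an instance after `T` rounds. -/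
def expectedRegret (ν : Instance M K) (A : Algorithm M K) (T : ℕ) : ℝ :=
  ∑ p : Fin M, ∑ i : Fin K, ν.gap p i * ∫ h, (pulls h p i : ℝ) ∂(historyLaw ν A T)

end

end MPMAB

/-! Suppose that every empirical mean, whether from a player's own samples or pooled from the other
players, is within its Hoeffding radius. Then the confidence bounds are valid, so an arm pulled by
player p has gap at most twice the width. As λ* minimizes the width, this holds with any weight λ in
place of λ* (`gap_le_two_mul_width`).

Weight 1 uses only the player's own samples and gives gap² · n ≲ ln T for every pulled arm. Weight 0
uses only the samples of the others, at the price of a bias 2ε. A subpar arm has gap above 3ε for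
all players, so this bias is absorbed and gap² · m ≲ ln T. The gaps of such an arm are comparable
across players, hence gap² times the collective number of pulls is ≲ ln T for all players at once
(`sq_gap_mul_samples_le`). Both bounds propagate from round to round (`pullBounds_snoc`).

Given these bounds, a subpar arm with N > 2M collective pulls costs ≲ √(N ln T) over all players
together, and one with fewer costs at most 2M. A non-subpar arm costs each player ≲ √(n ln T).
Cauchy–Schwarz over the arms removes the gaps and yields the square roots
(`regret_le_of_pullBounds`). The failure probability is polynomial in T times T⁻¹⁰, so failure adds
at most 1 to the expected regret.

Concentration under adaptive sampling comes from an exponential supermartingale and a union bound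
over the random sample size (`measure_deviation_gt_le`). -/

namespace MPMAB

variable {M K : ℕ}

/-! ### Pull counts and centred reward sums. -/

section Counting

theorem pulls_snoc {t : ℕ} (h : History M K t) (x : Fin M → Fin K × ℝ) (p : Fin M) (i : Fin K) :
    pulls (Fin.snoc h x : History M K (t + 1)) p i
      = pulls h p i + if (x p).1 = i then 1 else 0 := by
  simp only [pulls, Finset.card_filter, Fin.sum_univ_castSucc, Fin.snoc_castSucc, Fin.snoc_last]

theorem rewardSum_snoc {t : ℕ} (h : History M K t) (x : Fin M → Fin K × ℝ) (p : Fin M)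
    (i : Fin K) :
    rewardSum (Fin.snoc h x : History M K (t + 1)) p i
      = rewardSum h p i + if (x p).1 = i then (x p).2 else 0 := by
  simp only [rewardSum, Fin.sum_univ_castSucc, Fin.snoc_castSucc, Fin.snoc_last]

theorem sum_pulls {t : ℕ} (h : History M K t) (p : Fin M) : ∑ i, pulls h p i = t := by
  have := Finset.card_eq_sum_card_fiberwise (s := (Finset.univ : Finset (Fin t)))
    (t := (Finset.univ : Finset (Fin K))) (f := fun s => (h s p).1) (fun _ _ => by simp)
  simpa [pulls] using this.symm

theorem pulls_le {t : ℕ} (h : History M K t) (p : Fin M) (i : Fin K) : pulls h p i ≤ t :=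
  (Finset.card_filter_le _ _).trans (by simp)

/-- Number of pulls of arm `i` by the players in `Q`. -/
def samples {t : ℕ} (h : History M K t) (Q : Finset (Fin M)) (i : Fin K) : ℕ :=
  ∑ q ∈ Q, pulls h q i

/-- Sum of the centred rewards that the players in `Q` received from arm `i`. -/
noncomputable def deviation (ν : Instance M K) {t : ℕ} (h : History M K t) (Q : Finset (Fin M))
    (i : Fin K) : ℝ :=
  ∑ q ∈ Q, (rewardSum h q i - ν.mean q i * pulls h q i)

theorem samples_le {t : ℕ} (h : History M K t) (Q : Finset (Fin M)) (i : Fin K) :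
    samples h Q i ≤ M * t := by
  calc samples h Q i ≤ ∑ q ∈ Q, t := Finset.sum_le_sum fun q _ => pulls_le h q i
    _ ≤ M * t := by
      rw [Finset.sum_const, smul_eq_mul]
      exact Nat.mul_le_mul_right _ (by simpa using Finset.card_le_univ Q)

end Counting

/-! ### Measurability of the statistics of a history. -/

section Measurability

theorem measurable_snoc (t : ℕ) :
    Measurable fun x : History M K t × (Fin M → Fin K × ℝ) =>
      (Fin.snoc x.1 x.2 : History M K (t + 1)) := by
  refine measurable_pi_iff.2 fun s => ?_
  refine Fin.lastCases ?_ (fun s => ?_) s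
  · simpa using measurable_snd
  · simp only [Fin.snoc_castSucc]
    exact (measurable_pi_apply s).comp measurable_fst

theorem measurable_pulls {t : ℕ} (p : Fin M) (i : Fin K) :
    Measurable fun h : History M K t => pulls h p i := by
  simp only [pulls, Finset.card_filter]
  refine Finset.measurable_fun_sum _ fun s _ => Measurable.ite ?_ measurable_const measurable_const
  exact (measurableSet_singleton i).preimage
    (by fun_prop : Measurable fun h : History M K t => (h s p).1)

theorem measurable_rewardSum {t : ℕ} (p : Fin M) (i : Fin K) :
    Measurable fun h : History M K t => rewardSum h p i := by
  unfold rewardSum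
  refine Finset.measurable_fun_sum _ fun s _ => Measurable.ite ?_ (by fun_prop) measurable_const
  exact (measurableSet_singleton i).preimage
    (by fun_prop : Measurable fun h : History M K t => (h s p).1)

theorem measurable_samples {t : ℕ} (Q : Finset (Fin M)) (i : Fin K) :
    Measurable fun h : History M K t => samples h Q i :=
  Finset.measurable_fun_sum _ fun q _ => measurable_pulls q i

theorem measurable_deviation (ν : Instance M K) {t : ℕ} (Q : Finset (Fin M)) (i : Fin K) :
    Measurable fun h : History M K t => deviation ν h Q i := by
  refine Finset.measurable_fun_sum _ fun q _ => (measurable_rewardSum q i).sub ?_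
  exact measurable_const.mul (measurable_from_nat.comp (measurable_pulls q i))

theorem measurable_nBar {t : ℕ} (p : Fin M) (i : Fin K) :
    Measurable fun h : History M K t => nBar h p i := by
  unfold nBar
  exact measurable_const.max (measurable_pulls p i)

theorem measurable_mBar {t : ℕ} (p : Fin M) (i : Fin K) :
    Measurable fun h : History M K t => mBar h p i := by
  unfold mBar othersPulls
  exact measurable_const.max (Finset.measurable_fun_sum _ fun q _ => measurable_pulls q i)

theorem measurable_comp_nBar_mBar (f : ℕ → ℕ → ℝ) {t : ℕ} (p : Fin M) (i : Fin K) :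
    Measurable fun h : History M K t => f (nBar h p i) (mBar h p i) :=
  (measurable_of_countable fun x : ℕ × ℕ => f x.1 x.2).comp
    ((measurable_nBar p i).prodMk (measurable_mBar p i))

theorem measurable_ucb (T : ℕ) (ε : ℝ) {t : ℕ} (p : Fin M) (i : Fin K) :
    Measurable fun h : History M K t => ucb T ε h p i := by
  have hn := measurable_nBar (M := M) (K := K) (t := t) p i
  have hm := measurable_mBar (M := M) (K := K) (t := t) p i
  have hn' : Measurable fun h : History M K t => (nBar h p i : ℝ) := by fun_prop
  have hm' : Measurable fun h : History M K t => (mBar h p i : ℝ) := by fun_prop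
  have hl : Measurable fun h : History M K t => lamStar T ε (nBar h p i) (mBar h p i) :=
    measurable_comp_nBar_mBar (lamStar T ε) p i
  have hr := measurable_rewardSum (M := M) (K := K) (t := t) p i
  have hs : Measurable fun h : History M K t => ∑ q ∈ Finset.univ.erase p, rewardSum h q i :=
    Finset.measurable_fun_sum _ fun q _ => measurable_rewardSum q i
  have hk : Measurable fun h : History M K t =>
      kappa h p i (lamStar T ε (nBar h p i) (mBar h p i)) :=
    (hl.mul ((hn'.const_div 1).mul hr)).add
      ((hl.const_sub 1).mul ((hm'.const_div 1).mul hs))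
  have hw : Measurable fun h : History M K t =>
      width T ε (nBar h p i) (mBar h p i) (lamStar T ε (nBar h p i) (mBar h p i)) :=
    measurable_comp_nBar_mBar (fun n m => width T ε n m (lamStar T ε n m)) p i
  exact hk.add hw

end Measurability

/-! ### The joint law of the past and the next round. -/

section Kernels

theorem rewardKernel_apply (ν : Instance M K) (a : Fin M → Fin K) :
    rewardKernel ν a = Measure.pi fun p => (ν.reward p (a p)).map fun r => (a p, r) := rfl

theorem isProbabilityMeasure_map_reward (ν : Instance M K) (p : Fin M) (j : Fin K) :
    IsProbabilityMeasure ((ν.reward p j).map fun r => (j, r)) :=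
  have := ν.isProb p j
  Measure.isProbabilityMeasure_map (by fun_prop)

instance (ν : Instance M K) : IsMarkovKernel (rewardKernel ν) where
  isProbabilityMeasure a := by
    have := fun p => isProbabilityMeasure_map_reward ν p (a p)
    rw [rewardKernel_apply]
    infer_instance

instance (A : Algorithm M K) (t : ℕ) : IsMarkovKernel (A.policy t) := A.isMarkov t

instance (ν : Instance M K) (A : Algorithm M K) (t : ℕ) :
    IsProbabilityMeasure (historyLaw ν A t) := by
  induction t with
  | zero => unfold historyLaw; infer_instance
  | succ t ih =>
    unfold historyLaw
    exact Measure.isProbabilityMeasure_map (measurable_snoc t).aemeasurable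

theorem ae_rewardKernel_fst (ν : Instance M K) (a : Fin M → Fin K) :
    ∀ᵐ x ∂(rewardKernel ν a), ∀ p, (x p).1 = a p := by
  have := fun p => isProbabilityMeasure_map_reward ν p (a p)
  rw [rewardKernel_apply]
  refine ae_all_iff.2 fun p => ?_
  refine (Measure.tendsto_eval_ae_ae (μ := fun p => (ν.reward p (a p)).map fun r => (a p, r))
    (i := p)).eventually (p := fun y : Fin K × ℝ => y.1 = a p) ?_
  rw [ae_map_iff (p := fun y : Fin K × ℝ => y.1 = a p) (by fun_prop)
    ((measurableSet_singleton (a p)).preimage measurable_fst)]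
  simp

/-- Transfers optimality from the policy to the joint law of history and next round: the reward
kernel records the pulled arms unchanged. -/
theorem ae_ucb_le (ν : Instance M K) (A : Algorithm M K) {T t : ℕ} {ε : ℝ} (ht : t < T)
    (hA : A.IsRobustAgg T ε) :
    ∀ᵐ x ∂(historyLaw ν A t ⊗ₘ (rewardKernel ν ∘ₖ A.policy t)),
      ∀ p i, ucb T ε x.1 p i ≤ ucb T ε x.1 p (x.2 p).1 := by
  have hms : MeasurableSet {x : History M K t × (Fin M → Fin K × ℝ) |
      ∀ p i, ucb T ε x.1 p i ≤ ucb T ε x.1 p (x.2 p).1} := by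
    -- The index of the second bound is itself random; splitting over its value j leaves comparisons
    -- of measurable functions.
    have : {x : History M K t × (Fin M → Fin K × ℝ) |
        ∀ p i, ucb T ε x.1 p i ≤ ucb T ε x.1 p (x.2 p).1} =
        ⋂ p, ⋂ i, ⋂ j, ({x | (x.2 p).1 = j}ᶜ ∪ {x | ucb T ε x.1 p i ≤ ucb T ε x.1 p j}) := by
      ext x
      simp only [Set.mem_ofPred_eq, Set.mem_iInter, Set.mem_union, Set.mem_compl_iff]
      refine ⟨fun h p i j => ?_, fun h p i => (h p i _).resolve_left (not_not.2 rfl)⟩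
      by_cases hj : (x.2 p).1 = j
      · exact Or.inr (hj ▸ h p i)
      · exact Or.inl hj
    rw [this]
    refine MeasurableSet.iInter fun p => MeasurableSet.iInter fun i => MeasurableSet.iInter fun j =>
      MeasurableSet.union (MeasurableSet.compl ?_) ?_
    · exact (measurableSet_singleton j).preimage
        (by fun_prop : Measurable fun x : History M K t × (Fin M → Fin K × ℝ) => (x.2 p).1)
    · exact measurableSet_le ((measurable_ucb T ε p i).comp measurable_fst)
        ((measurable_ucb T ε p j).comp measurable_fst)
  refine Measure.ae_compProd_of_ae_ae hms (Filter.Eventually.of_forall fun h => ?_)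
  refine Kernel.ae_comp_of_ae_ae (hms.preimage measurable_prodMk_left) ?_
  filter_upwards [hA t ht h] with a ha
  filter_upwards [ae_rewardKernel_fst ν a] with x hx p i
  rw [hx p]
  exact ha p i

end Kernels

/-! ### Hoeffding's inequality for adaptively chosen samples. -/

section Concentration

theorem ae_reward_mem_Icc (ν : Instance M K) (p : Fin M) (i : Fin K) :
    ∀ᵐ r ∂(ν.reward p i), r ∈ Set.Icc (0 : ℝ) 1 := ν.supp p i

theorem mean_mem_Icc (ν : Instance M K) (p : Fin M) (i : Fin K) :
    ν.mean p i ∈ Set.Icc (0 : ℝ) 1 := by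
  have := ν.isProb p i
  have h := ae_reward_mem_Icc ν p i
  refine ⟨integral_nonneg_of_ae (h.mono fun r hr => hr.1), ?_⟩
  have hi : Integrable (fun r : ℝ => r) (ν.reward p i) :=
    Integrable.of_mem_Icc 0 1 aemeasurable_id h
  exact (integral_mono_ae hi (integrable_const (1 : ℝ)) (h.mono fun r hr => hr.2)).trans (by simp)

/-- The increment factor, contributed by player `q`, of the exponential supermartingale. -/
noncomputable def expFactor (ν : Instance M K) (θ : ℝ) (Q : Finset (Fin M)) (i : Fin K) (q : Fin M)
    (y : Fin K × ℝ) : ℝ :=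
  Real.exp (if q ∈ Q ∧ y.1 = i then θ * (y.2 - ν.mean q i) - θ ^ 2 / 8 else 0)

/-- Hoeffding's lemma: a variable in [0, 1] is sub-Gaussian with variance proxy 1/4, which the term
θ²/8 compensates. A reward from another arm or player contributes the factor 1. -/
theorem integrable_expFactor_and_integral_le (ν : Instance M K) (θ : ℝ) (Q : Finset (Fin M))
    (i : Fin K) (q : Fin M) (j : Fin K) :
    Integrable (expFactor ν θ Q i q) ((ν.reward q j).map fun r => (j, r)) ∧
      ∫ y, expFactor ν θ Q i q y ∂((ν.reward q j).map fun r => (j, r)) ≤ 1 := by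
  have := ν.isProb q j
  have hme : MeasurableEmbedding fun r : ℝ => (j, r) := measurableEmbedding_prodMk_left j
  rw [hme.integrable_map_iff, hme.integral_map]
  by_cases hq : q ∈ Q ∧ j = i
  · obtain ⟨hq, rfl⟩ := hq
    have hs := hasSubgaussianMGF_of_mem_Icc (X := fun r : ℝ => r) aemeasurable_id
      (ae_reward_mem_Icc ν q j)
    have he : (fun r : ℝ => expFactor ν θ Q j q (j, r)) =
        fun r => Real.exp (θ * (r - ν.mean q j)) * Real.exp (-(θ ^ 2 / 8)) := by
      ext r
      simp [expFactor, hq, ← Real.exp_add, sub_eq_add_neg]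
    have hle := hs.mgf_le θ
    refine ⟨?_, ?_⟩
    · change Integrable (fun r : ℝ => expFactor ν θ Q j q (j, r)) _
      rw [he]
      exact (hs.integrable_exp_mul θ).mul_const _
    · rw [he, integral_mul_const, Real.exp_neg, ← div_eq_mul_inv, div_le_one (Real.exp_pos _)]
      refine hle.trans (Real.exp_le_exp.2 (le_of_eq ?_))
      norm_num
      ring
  · have he : (fun r : ℝ => expFactor ν θ Q i q (j, r)) = fun _ => 1 := by
      ext r
      simp [expFactor, hq]
    refine ⟨?_, ?_⟩
    · change Integrable (fun r : ℝ => expFactor ν θ Q i q (j, r)) _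
      rw [he]
      exact integrable_const _
    · rw [he]
      simp

theorem lintegral_prod_expFactor_le (ν : Instance M K) (θ : ℝ) (Q : Finset (Fin M))
    (i : Fin K) (a : Fin M → Fin K) :
    ∫⁻ x, ENNReal.ofReal (∏ q, expFactor ν θ Q i q (x q)) ∂(rewardKernel ν a) ≤ 1 := by
  have := fun p => isProbabilityMeasure_map_reward ν p (a p)
  have hf := fun q => integrable_expFactor_and_integral_le ν θ Q i q (a q)
  rw [rewardKernel_apply, ← ofReal_integral_eq_lintegral_ofReal
    (Integrable.fintype_prod fun q => (hf q).1)
    (Filter.Eventually.of_forall fun x => Finset.prod_nonneg fun q _ => (Real.exp_pos _).le),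
    integral_fintype_prod_eq_prod, ENNReal.ofReal_le_one]
  exact Finset.prod_le_one (fun q _ => integral_nonneg fun _ => (Real.exp_pos _).le)
    fun q _ => (hf q).2

/-- The exponential supermartingale. -/
noncomputable def expProcess (ν : Instance M K) (θ : ℝ) (Q : Finset (Fin M)) (i : Fin K) {t : ℕ}
    (h : History M K t) : ℝ :=
  Real.exp (θ * deviation ν h Q i - θ ^ 2 / 8 * samples h Q i)

theorem expProcess_snoc (ν : Instance M K) (θ : ℝ) (Q : Finset (Fin M)) (i : Fin K) {t : ℕ}
    (h : History M K t) (x : Fin M → Fin K × ℝ) :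
    expProcess ν θ Q i (Fin.snoc h x : History M K (t + 1)) =
      expProcess ν θ Q i h * ∏ q, expFactor ν θ Q i q (x q) := by
  simp only [expProcess, expFactor, ← Real.exp_sum, ← Real.exp_add]
  congr 1
  have h1 : ∑ q, (if q ∈ Q ∧ (x q).1 = i then θ * ((x q).2 - ν.mean q i) - θ ^ 2 / 8 else 0)
      = ∑ q ∈ Q, (if (x q).1 = i then θ * ((x q).2 - ν.mean q i) - θ ^ 2 / 8 else 0) := by
    simp only [ite_and]
    rw [Finset.sum_ite_mem, Finset.univ_inter]
  rw [h1]
  simp only [deviation, samples, Nat.cast_sum, Finset.mul_sum, ← Finset.sum_sub_distrib,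
    ← Finset.sum_add_distrib]
  refine Finset.sum_congr rfl fun q _ => ?_
  rw [pulls_snoc, rewardSum_snoc]
  split_ifs <;> push_cast <;> ring

theorem measurable_expProcess (ν : Instance M K) (θ : ℝ) (Q : Finset (Fin M)) (i : Fin K) {t : ℕ} :
    Measurable fun h : History M K t => expProcess ν θ Q i h := by
  have h1 := measurable_deviation ν (t := t) Q i
  have h2 : Measurable fun h : History M K t => (samples h Q i : ℝ) :=
    measurable_from_nat.comp (measurable_samples Q i)
  unfold expProcess
  fun_prop

theorem measurable_prod_expFactor (ν : Instance M K) (θ : ℝ) (Q : Finset (Fin M)) (i : Fin K) :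
    Measurable fun x : Fin M → Fin K × ℝ => ∏ q, expFactor ν θ Q i q (x q) := by
  refine Finset.measurable_fun_prod _ fun q _ => ?_
  unfold expFactor
  refine Real.measurable_exp.comp (Measurable.ite ?_ (by fun_prop) measurable_const)
  exact (MeasurableSet.const _).inter ((measurableSet_singleton i).preimage
    (by fun_prop : Measurable fun x : Fin M → Fin K × ℝ => (x q).1))

/-- Given the arms of a round, the rewards are independent and the new factor has mean at most 1.
This is uniform in the arms, so the way they depend on the past is irrelevant. -/
theorem lintegral_expProcess_le (ν : Instance M K) (A : Algorithm M K) (θ : ℝ)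
    (Q : Finset (Fin M)) (i : Fin K) (t : ℕ) :
    ∫⁻ h, ENNReal.ofReal (expProcess ν θ Q i h) ∂(historyLaw ν A t) ≤ 1 := by
  induction t with
  | zero =>
    have : ∀ h : History M K 0, expProcess ν θ Q i h = 1 := fun h => by
      simp [expProcess, deviation, samples, pulls, rewardSum]
    simp [this]
  | succ t ih =>
    rw [historyLaw, lintegral_map (measurable_expProcess ν θ Q i).ennreal_ofReal
      (measurable_snoc t), Measure.lintegral_compProd
      (f := fun x : History M K t × (Fin M → Fin K × ℝ) => ENNReal.ofReal
        (expProcess ν θ Q i (Fin.snoc x.1 x.2 : History M K (t + 1))))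
      ((measurable_expProcess ν θ Q i).comp (measurable_snoc t)).ennreal_ofReal]
    refine le_trans (lintegral_mono fun h => ?_) ih
    simp only [expProcess_snoc]
    have hm := (measurable_prod_expFactor ν θ Q i).ennreal_ofReal
    simp_rw [ENNReal.ofReal_mul (p := expProcess ν θ Q i h) (Real.exp_pos _).le]
    rw [lintegral_const_mul _ hm, Kernel.lintegral_comp _ _ _ hm]
    refine mul_le_of_le_one_right zero_le ?_
    refine (lintegral_mono fun a => lintegral_prod_expFactor_le ν θ Q i a).trans ?_
    simp

theorem measure_expProcess_ge_le (ν : Instance M K) (A : Algorithm M K) (θ s : ℝ)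
    (Q : Finset (Fin M)) (i : Fin K) (t : ℕ) :
    historyLaw ν A t {h | Real.exp s ≤ expProcess ν θ Q i h} ≤ ENNReal.ofReal (Real.exp (-s)) := by
  have h1 := (mul_meas_ge_le_lintegral (measurable_expProcess ν θ Q i).ennreal_ofReal
    (ENNReal.ofReal (Real.exp s))).trans (lintegral_expProcess_le ν A θ Q i t)
  have h2 : {h : History M K t | ENNReal.ofReal (Real.exp s) ≤
      ENNReal.ofReal (expProcess ν θ Q i h)} = {h | Real.exp s ≤ expProcess ν θ Q i h} := by
    ext h
    simp only [Set.mem_ofPred_eq]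
    exact ENNReal.ofReal_le_ofReal_iff (Real.exp_pos _).le
  rw [h2] at h1
  rw [Real.exp_neg, ENNReal.ofReal_inv_of_pos (Real.exp_pos _)]
  rwa [ENNReal.le_inv_iff_mul_le, mul_comm]

/-- Hoeffding's inequality for the samples of a set of players, uniformly in the sample size. -/
theorem measure_deviation_gt_le (ν : Instance M K) (A : Algorithm M K) {L : ℝ} (hL : 0 ≤ L)
    (Q : Finset (Fin M)) (i : Fin K) (t : ℕ) :
    historyLaw ν A t {h | 0 < samples h Q i ∧ 5 * L * samples h Q i < deviation ν h Q i ^ 2} ≤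
      (2 * (M * t) : ℕ) * ENNReal.ofReal (Real.exp (-(10 * L))) := by
  -- For sample size N this θ maximizes θ√(5LN) − θ²N/8, with value 10L. Since the size is random, a
  -- union is taken over its at most M·t positive values and over both signs.
  set θ : ℕ → ℝ := fun N => 4 * √(5 * L) / √N with hθ
  have hsub : {h : History M K t | 0 < samples h Q i ∧
      5 * L * samples h Q i < deviation ν h Q i ^ 2} ⊆
      ⋃ N ∈ Finset.Icc 1 (M * t), ({h | Real.exp (10 * L) ≤ expProcess ν (θ N) Q i h} ∪
        {h | Real.exp (10 * L) ≤ expProcess ν (-θ N) Q i h}) := by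
    rintro h ⟨h0, hd⟩
    simp only [Set.mem_iUnion, Finset.mem_Icc]
    refine ⟨samples h Q i, ⟨h0, samples_le h Q i⟩, ?_⟩
    have hN : (0 : ℝ) < samples h Q i := by exact_mod_cast h0
    set N : ℝ := ((samples h Q i : ℕ) : ℝ)
    have hsN := Real.sqrt_pos.2 hN
    have hsq := Real.sq_sqrt hN.le
    have hsL := Real.sq_sqrt (by positivity : 0 ≤ 5 * L)
    have hsL0 := Real.sqrt_nonneg (5 * L)
    have hθ2 : (θ (samples h Q i)) ^ 2 / 8 * N = 10 * L := by
      simp only [hθ]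
      rw [div_pow, mul_pow, hsL, hsq]
      field_simp
      ring
    have habs : √(5 * L) * √N ≤ |deviation ν h Q i| := by
      apply le_of_sq_le_sq _ (abs_nonneg _)
      rw [sq_abs, mul_pow, hsL, hsq]
      exact hd.le
    have hmul : 20 * L ≤ θ (samples h Q i) * |deviation ν h Q i| := by
      have h20 : θ (samples h Q i) * (√(5 * L) * √N) = 20 * L := by
        simp only [hθ]
        field_simp
        nlinarith
      rw [← h20]
      exact mul_le_mul_of_nonneg_left habs (by positivity)
    rcases abs_cases (deviation ν h Q i) with ⟨he, -⟩ | ⟨he, -⟩ <;> rw [he] at hmul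
    · left
      simp only [Set.mem_ofPred_eq, expProcess]
      exact Real.exp_le_exp.2 (by linarith)
    · right
      simp only [Set.mem_ofPred_eq, expProcess, neg_sq]
      exact Real.exp_le_exp.2 (by linarith)
  refine (measure_mono hsub).trans ((measure_biUnion_finset_le _ _).trans ?_)
  refine (Finset.sum_le_card_nsmul _ _ (2 * ENNReal.ofReal (Real.exp (-(10 * L))))
    fun N _ => (measure_union_le _ _).trans ?_).trans (le_of_eq ?_)
  · rw [two_mul]
    exact add_le_add (measure_expProcess_ge_le _ _ _ _ _ _ _)
      (measure_expProcess_ge_le _ _ _ _ _ _ _)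
  · rw [Nat.card_Icc, nsmul_eq_mul]
    push_cast
    ring

end Concentration

/-! ### Comparison of gaps between players. -/

section Gaps

theorem le_optMean (ν : Instance M K) (p : Fin M) (i : Fin K) : ν.mean p i ≤ ν.optMean p :=
  le_ciSup (Set.finite_range _).bddAbove i

theorem exists_mean_eq_optMean (ν : Instance M K) (hK : 0 < K) (p : Fin M) :
    ∃ i, ν.mean p i = ν.optMean p :=
  have : Nonempty (Fin K) := ⟨⟨0, hK⟩⟩
  exists_eq_ciSup_of_finite

theorem gap_nonneg (ν : Instance M K) (p : Fin M) (i : Fin K) : 0 ≤ ν.gap p i :=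
  sub_nonneg.2 (le_optMean ν p i)

theorem gap_le_one (ν : Instance M K) (p : Fin M) (i : Fin K) : ν.gap p i ≤ 1 := by
  obtain ⟨j, hj⟩ := exists_mean_eq_optMean ν i.pos p
  have h1 := mean_mem_Icc ν p i
  have h2 := mean_mem_Icc ν p j
  rw [Instance.gap, ← hj]
  linarith [h1.1, h2.2]

/-- A change of player moves both the optimal mean and the mean of the arm by at most ε. -/
theorem gap_le_add {ν : Instance M K} {ε : ℝ} (hν : ν.IsDissimilar ε) (p q : Fin M)
    (i : Fin K) : ν.gap p i ≤ ν.gap q i + 2 * ε := by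
  obtain ⟨j, hj⟩ := exists_mean_eq_optMean ν i.pos p
  have h1 := abs_le.1 (hν.2 p q i)
  have h2 := abs_le.1 (hν.2 p q j)
  have h3 := le_optMean ν q j
  rw [Instance.gap, Instance.gap, ← hj]
  linarith [h1.1, h2.2]

theorem mem_subpar {ν : Instance M K} {ε : ℝ} {i : Fin K} :
    i ∈ ν.subpar ε ↔ ∃ p, 5 * ε < ν.gap p i := by
  simp [Instance.subpar]

theorem lt_gap_of_mem_subpar {ν : Instance M K} {ε : ℝ} (hν : ν.IsDissimilar ε) {i : Fin K}
    (hi : i ∈ ν.subpar ε) (p : Fin M) : 3 * ε < ν.gap p i := by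
  obtain ⟨q, hq⟩ := mem_subpar.1 hi
  linarith [gap_le_add hν q p i]

theorem notMem_subpar_of_gap_eq_zero {ν : Instance M K} {ε : ℝ} (hν : ν.IsDissimilar ε)
    {p : Fin M} {i : Fin K} (h : ν.gap p i = 0) : i ∉ ν.subpar ε := fun hi => by
  linarith [lt_gap_of_mem_subpar hν hi p, hν.1.1]

theorem exists_gap_eq_zero (ν : Instance M K) (hK : 0 < K) (p : Fin M) : ∃ i, ν.gap p i = 0 := by
  obtain ⟨i, hi⟩ := exists_mean_eq_optMean ν hK p
  exact ⟨i, sub_eq_zero.2 hi.symm⟩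

end Gaps

/-! ### Validity of the confidence bounds and its consequences for pulled arms. -/

section ConfidenceBounds

/-- For every player and every arm, the samples of the player and those of the other players
deviate little from their means. -/
def Concentrated (ν : Instance M K) (L : ℝ) {t : ℕ} (h : History M K t) : Prop :=
  ∀ (p : Fin M) (i : Fin K) (Q : Finset (Fin M)), Q = {p} ∨ Q = Finset.univ.erase p →
    0 < samples h Q i → deviation ν h Q i ^ 2 ≤ 5 * L * samples h Q i

theorem measure_not_concentrated_le (ν : Instance M K) (A : Algorithm M K) {L : ℝ} (hL : 0 ≤ L)
    (t : ℕ) :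
    historyLaw ν A t {h | ¬ Concentrated ν L h} ≤
      (M * (K * (4 * (M * t))) : ℕ) * ENNReal.ofReal (Real.exp (-(10 * L))) := by
  set B : Finset (Fin M) → Fin K → Set (History M K t) := fun Q i =>
    {h | 0 < samples h Q i ∧ 5 * L * samples h Q i < deviation ν h Q i ^ 2} with hB
  have hsub : {h : History M K t | ¬ Concentrated ν L h} ⊆
      ⋃ p ∈ (Finset.univ : Finset (Fin M)), ⋃ i ∈ (Finset.univ : Finset (Fin K)),
        (B {p} i ∪ B (Finset.univ.erase p) i) := by
    intro h hh
    simp only [Set.mem_ofPred_eq, Concentrated] at hh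
    push Not at hh
    obtain ⟨p, i, Q, hQ, h0, hd⟩ := hh
    simp only [Finset.mem_univ, Set.iUnion_true, Set.mem_iUnion]
    refine ⟨p, i, ?_⟩
    rcases hQ with rfl | rfl
    · exact Or.inl ⟨h0, hd⟩
    · exact Or.inr ⟨h0, hd⟩
  set e := ENNReal.ofReal (Real.exp (-(10 * L)))
  have h1 : ∀ (p : Fin M) (i : Fin K),
      historyLaw ν A t (B {p} i ∪ B (Finset.univ.erase p) i) ≤ (4 * (M * t) : ℕ) * e := by
    intro p i
    refine (measure_union_le _ _).trans ((add_le_add (measure_deviation_gt_le ν A hL _ i t)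
      (measure_deviation_gt_le ν A hL _ i t)).trans (le_of_eq ?_))
    push_cast
    ring
  refine (measure_mono hsub).trans ((measure_biUnion_finset_le _ _).trans ?_)
  refine (Finset.sum_le_card_nsmul _ _ ((K * (4 * (M * t)) : ℕ) * e) fun p _ => ?_).trans
    (le_of_eq ?_)
  · refine (measure_biUnion_finset_le _ _).trans
      ((Finset.sum_le_card_nsmul _ _ _ fun i _ => h1 p i).trans (le_of_eq ?_))
    simp [mul_assoc]
  · simp [mul_assoc]

theorem rewardSum_eq_zero {t : ℕ} {h : History M K t} {p : Fin M} {i : Fin K}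
    (h0 : pulls h p i = 0) : rewardSum h p i = 0 := by
  rw [pulls, Finset.card_eq_zero, Finset.filter_eq_empty_iff] at h0
  exact Finset.sum_eq_zero fun s hs => if_neg (h0 hs)

theorem sq_zeta_sub_mul_le {ν : Instance M K} {L : ℝ} (hL : 1 ≤ 5 * L) {t : ℕ}
    {h : History M K t} (hc : Concentrated ν L h) (p : Fin M) (i : Fin K) :
    (zeta h p i - ν.mean p i) ^ 2 * nBar h p i ≤ 5 * L := by
  -- Without samples the estimate is 0 and `nBar` is 1; the squared error is at most 1, which is
  -- where 1 ≤ 5L is needed.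
  rcases Nat.eq_zero_or_pos (pulls h p i) with h0 | h0
  · have hμ := mean_mem_Icc ν p i
    simp only [zeta, nBar, h0, rewardSum_eq_zero h0]
    norm_num
    nlinarith [hμ.1, hμ.2]
  · have hb : nBar h p i = pulls h p i := max_eq_right h0
    have hd := hc p i {p} (Or.inl rfl) (by simpa [samples] using h0)
    simp only [deviation, samples, Finset.sum_singleton] at hd
    have hn : (0 : ℝ) < pulls h p i := by exact_mod_cast h0
    have he : zeta h p i - ν.mean p i
        = (rewardSum h p i - ν.mean p i * pulls h p i) / pulls h p i := by
      rw [zeta, hb]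
      field_simp
    rw [he, hb, div_pow, div_mul_eq_mul_div, div_le_iff₀ (by positivity)]
    nlinarith

theorem exists_sq_eta_sub_mul_le {ν : Instance M K} {ε L : ℝ} (hν : ν.IsDissimilar ε)
    (hL : 1 ≤ 5 * L) {t : ℕ} {h : History M K t} (hc : Concentrated ν L h) (p : Fin M)
    (i : Fin K) :
    ∃ μ : ℝ, |μ - ν.mean p i| ≤ ε ∧ (eta h p i - μ) ^ 2 * mBar h p i ≤ 5 * L := by
  rcases Nat.eq_zero_or_pos (othersPulls h p i) with h0 | h0
  · have hμ := mean_mem_Icc ν p i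
    have hs : ∑ q ∈ Finset.univ.erase p, rewardSum h q i = 0 :=
      Finset.sum_eq_zero fun q hq => rewardSum_eq_zero (Finset.sum_eq_zero_iff.1 h0 q hq)
    refine ⟨ν.mean p i, by simpa using hν.1.1, ?_⟩
    simp only [eta, mBar, h0, hs]
    norm_num
    nlinarith [hμ.1, hμ.2]
  · have hb : mBar h p i = othersPulls h p i := max_eq_right h0
    have hd := hc p i (Finset.univ.erase p) (Or.inr rfl) h0
    have hm : (0 : ℝ) < othersPulls h p i := by exact_mod_cast h0
    have hsm : ∑ q ∈ Finset.univ.erase p, (pulls h q i : ℝ) = othersPulls h p i := by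
      simp [othersPulls]
    change _ ≤ 5 * L * (othersPulls h p i : ℝ) at hd
    -- The pooled estimate is centred at the average of the other players' means weighted by their
    -- pulls, a random quantity within ε of the mean of p.
    refine ⟨(∑ q ∈ Finset.univ.erase p, ν.mean q i * pulls h q i) / othersPulls h p i, ?_, ?_⟩
    · have he : (∑ q ∈ Finset.univ.erase p, ν.mean q i * pulls h q i) / othersPulls h p i
          - ν.mean p i = (∑ q ∈ Finset.univ.erase p, (ν.mean q i - ν.mean p i) * pulls h q i)
            / othersPulls h p i := by
        simp only [sub_mul, Finset.sum_sub_distrib, ← Finset.mul_sum, hsm]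
        field_simp
      rw [he, abs_div, abs_of_pos hm, div_le_iff₀ hm]
      refine (Finset.abs_sum_le_sum_abs _ _).trans ?_
      rw [← hsm, Finset.mul_sum]
      refine Finset.sum_le_sum fun q _ => ?_
      rw [abs_mul, Nat.abs_cast]
      exact mul_le_mul_of_nonneg_right (hν.2 q p i) (Nat.cast_nonneg _)
    · have he : eta h p i - (∑ q ∈ Finset.univ.erase p, ν.mean q i * pulls h q i)
          / othersPulls h p i = deviation ν h (Finset.univ.erase p) i / othersPulls h p i := by
        rw [eta, hb, deviation, Finset.sum_sub_distrib]
        field_simp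
      rw [he, hb, div_pow, div_mul_eq_mul_div, div_le_iff₀ (by positivity)]
      nlinarith

theorem abs_kappa_sub_le_width {ν : Instance M K} {ε : ℝ} {T : ℕ} (hν : ν.IsDissimilar ε)
    (hL : 1 ≤ 5 * Real.log T) {t : ℕ} {h : History M K t}
    (hc : Concentrated ν (Real.log T) h) (p : Fin M) (i : Fin K) {lam : ℝ}
    (hlam : lam ∈ Set.Icc (0 : ℝ) 1) :
    |kappa h p i lam - ν.mean p i| ≤ width T ε (nBar h p i) (mBar h p i) lam := by
  have hz := sq_zeta_sub_mul_le hL hc p i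
  obtain ⟨μ, hμ, he⟩ := exists_sq_eta_sub_mul_le hν hL hc p i
  have hn : (0 : ℝ) < nBar h p i := by exact_mod_cast (le_max_left 1 _ : 1 ≤ nBar h p i)
  have hm : (0 : ℝ) < mBar h p i := by exact_mod_cast (le_max_left 1 _ : 1 ≤ mBar h p i)
  rw [width]
  generalize (nBar h p i : ℝ) = n at *
  generalize (mBar h p i : ℝ) = m at *
  set L := Real.log T
  have hsplit : kappa h p i lam - ν.mean p i
      = (lam * (zeta h p i - ν.mean p i) + (1 - lam) * (eta h p i - μ))
        + (1 - lam) * (μ - ν.mean p i) := by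
    rw [kappa]; ring
  rw [hsplit]
  refine (abs_add_le _ _).trans (add_le_add ?_ ?_)
  · rw [← le_div_iff₀ hn] at hz
    rw [← le_div_iff₀ hm] at he
    generalize zeta h p i - ν.mean p i = x at *
    generalize eta h p i - μ = y at *
    -- From (u + v)² ≤ 2(u² + v²) the factor 10 in front of L would do; 64 · 13 leaves ample room.
    have h1 : (lam * x + (1 - lam) * y) ^ 2 ≤
        64 * (13 * L * (lam ^ 2 / n + (1 - lam) ^ 2 / m)) := by
      have h2 : lam ^ 2 * x ^ 2 ≤ lam ^ 2 * (5 * L / n) :=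
        mul_le_mul_of_nonneg_left hz (sq_nonneg _)
      have h3 : (1 - lam) ^ 2 * y ^ 2 ≤ (1 - lam) ^ 2 * (5 * L / m) :=
        mul_le_mul_of_nonneg_left he (sq_nonneg _)
      have h4 : (0 : ℝ) ≤ L * (lam ^ 2 / n + (1 - lam) ^ 2 / m) := by
        have : 0 ≤ L := by linarith
        positivity
      have h5 : lam ^ 2 * (5 * L / n) + (1 - lam) ^ 2 * (5 * L / m)
          = 5 * (L * (lam ^ 2 / n + (1 - lam) ^ 2 / m)) := by ring
      nlinarith [sq_nonneg (lam * x - (1 - lam) * y)]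
    have h6 : 8 * √(13 * L * (lam ^ 2 / n + (1 - lam) ^ 2 / m))
        = √(64 * (13 * L * (lam ^ 2 / n + (1 - lam) ^ 2 / m))) := by
      rw [Real.sqrt_mul (by norm_num : (0 : ℝ) ≤ 64), show (64 : ℝ) = 8 ^ 2 by norm_num,
        Real.sqrt_sq (by norm_num)]
    rw [h6]
    exact Real.abs_le_sqrt h1
  · rw [abs_mul, abs_of_nonneg (by linarith [hlam.2])]
    exact mul_le_mul_of_nonneg_left hμ (by linarith [hlam.2])

theorem lamStar_mem (T : ℕ) (ε : ℝ) (n m : ℕ) : lamStar T ε n m ∈ Set.Icc (0 : ℝ) 1 :=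
  (exists_isMinOn_width T ε n m).choose_spec.1

theorem width_lamStar_le (T : ℕ) (ε : ℝ) (n m : ℕ) {lam : ℝ} (hlam : lam ∈ Set.Icc (0 : ℝ) 1) :
    width T ε n m (lamStar T ε n m) ≤ width T ε n m lam :=
  (exists_isMinOn_width T ε n m).choose_spec.2 hlam

/-- An arm pulled by an optimistic player has a small gap. -/
theorem gap_le_two_mul_width {ν : Instance M K} {ε : ℝ} {T : ℕ} (hν : ν.IsDissimilar ε)
    (hL : 1 ≤ 5 * Real.log T) {t : ℕ} {h : History M K t}
    (hc : Concentrated ν (Real.log T) h) {p : Fin M} {i : Fin K}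
    (hi : ∀ j, ucb T ε h p j ≤ ucb T ε h p i) {lam : ℝ} (hlam : lam ∈ Set.Icc (0 : ℝ) 1) :
    ν.gap p i ≤ 2 * width T ε (nBar h p i) (mBar h p i) lam := by
  obtain ⟨j, hj⟩ := exists_mean_eq_optMean ν i.pos p
  -- With j optimal: mean of j ≤ UCB of j ≤ UCB of i ≤ mean of i + 2 · width, and the width at λ* is
  -- at most that at `lam`.
  have h1 := abs_le.1 (abs_kappa_sub_le_width hν hL hc p i
    (lamStar_mem T ε (nBar h p i) (mBar h p i)))
  have h2 := abs_le.1 (abs_kappa_sub_le_width hν hL hc p j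
    (lamStar_mem T ε (nBar h p j) (mBar h p j)))
  have h3 := hi j
  have h4 := width_lamStar_le T ε (nBar h p i) (mBar h p i) hlam
  rw [ucb, ucb] at h3
  rw [Instance.gap, ← hj]
  linarith [h1.2, h2.1]

theorem sq_mul_le_of_le_sqrt_div {g L n : ℝ} (hg : 0 ≤ g) (hL : 0 ≤ L) (hn : 0 < n) {c : ℝ}
    (h : g ≤ c * √(13 * L * (1 / n))) : g ^ 2 * n ≤ c ^ 2 * (13 * L) := by
  have h1 := pow_le_pow_left₀ hg h 2
  rw [mul_pow, Real.sq_sqrt (by positivity)] at h1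
  calc g ^ 2 * n ≤ c ^ 2 * (13 * L * (1 / n)) * n := mul_le_mul_of_nonneg_right h1 hn.le
    _ = c ^ 2 * (13 * L) := by field_simp

theorem sq_gap_mul_nBar_le {ν : Instance M K} {ε : ℝ} {T : ℕ} (hν : ν.IsDissimilar ε)
    (hL : 1 ≤ 5 * Real.log T) {t : ℕ} {h : History M K t}
    (hc : Concentrated ν (Real.log T) h) {p : Fin M} {i : Fin K}
    (hi : ∀ j, ucb T ε h p j ≤ ucb T ε h p i) :
    ν.gap p i ^ 2 * nBar h p i ≤ 3328 * Real.log T := by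
  have h1 := gap_le_two_mul_width hν hL hc hi (lam := 1) (by simp)
  have hn : (0 : ℝ) < nBar h p i := by exact_mod_cast (le_max_left 1 _ : 1 ≤ nBar h p i)
  -- At weight 1 the bias vanishes, and 3328 = 16² · 13.
  have h2 := sq_mul_le_of_le_sqrt_div (gap_nonneg ν p i) (by linarith) hn (c := 16)
    (L := Real.log T) (by rw [width] at h1; norm_num at h1 ⊢; linarith)
  linarith

theorem sq_gap_mul_mBar_le {ν : Instance M K} {ε : ℝ} {T : ℕ} (hν : ν.IsDissimilar ε)
    (hL : 1 ≤ 5 * Real.log T) {t : ℕ} {h : History M K t}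
    (hc : Concentrated ν (Real.log T) h) {p : Fin M} {i : Fin K}
    (hi : ∀ j, ucb T ε h p j ≤ ucb T ε h p i) (hs : i ∈ ν.subpar ε) :
    ν.gap p i ^ 2 * mBar h p i ≤ 9 * (3328 * Real.log T) := by
  have h1 := gap_le_two_mul_width hν hL hc hi (lam := 0) (by simp)
  have hg := lt_gap_of_mem_subpar hν hs p
  have hm : (0 : ℝ) < mBar h p i := by exact_mod_cast (le_max_left 1 _ : 1 ≤ mBar h p i)
  -- The bias 2ε is below two thirds of the gap, so a third of the gap is at most 16√(13L/m); this
  -- gives 48 = 3 · 16.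
  have h2 := sq_mul_le_of_le_sqrt_div (gap_nonneg ν p i) (by linarith) hm (c := 48)
    (L := Real.log T) (by rw [width] at h1; norm_num at h1 ⊢; linarith)
  linarith

theorem sq_gap_mul_samples_le {ν : Instance M K} {ε : ℝ} {T : ℕ} (hν : ν.IsDissimilar ε)
    (hL : 1 ≤ 5 * Real.log T) {t : ℕ} {h : History M K t}
    (hc : Concentrated ν (Real.log T) h) {p : Fin M} {i : Fin K}
    (hi : ∀ j, ucb T ε h p j ≤ ucb T ε h p i) (hs : i ∈ ν.subpar ε) (q : Fin M) :
    ν.gap q i ^ 2 * samples h Finset.univ i ≤ 50 * (3328 * Real.log T) := by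
  have h1 := sq_gap_mul_nBar_le hν hL hc hi
  have h2 := sq_gap_mul_mBar_le hν hL hc hi hs
  have hsum : samples h Finset.univ i = pulls h p i + othersPulls h p i :=
    (Finset.add_sum_erase _ _ (Finset.mem_univ p)).symm
  have hle : (samples h Finset.univ i : ℝ) ≤ nBar h p i + mBar h p i := by
    rw [hsum]
    exact_mod_cast add_le_add (le_max_right 1 _) (le_max_right 1 _)
  -- Here 2ε is below two thirds of the gap of p. The final constant 50 exceeds 25/9 · (1 + 9).
  have hg : ν.gap q i ≤ 5 / 3 * ν.gap p i := by
    linarith [gap_le_add hν q p i, lt_gap_of_mem_subpar hν hs p]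
  have hg2 : ν.gap q i ^ 2 ≤ 25 / 9 * ν.gap p i ^ 2 := by
    have := pow_le_pow_left₀ (gap_nonneg ν q i) hg 2
    linarith [mul_pow (5 / 3 : ℝ) (ν.gap p i) 2]
  calc ν.gap q i ^ 2 * samples h Finset.univ i
      ≤ 25 / 9 * ν.gap p i ^ 2 * (nBar h p i + mBar h p i) := by gcongr
    _ ≤ 50 * (3328 * Real.log T) := by nlinarith

end ConfidenceBounds

/-! ### Propagation of the pull bounds through the rounds. -/

section Invariant

/-- The bounds on the numbers of pulls that the algorithm maintains with high probability. -/
def PullBounds (ν : Instance M K) (ε a : ℝ) {t : ℕ} (h : History M K t) : Prop :=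
  ∀ (p : Fin M) (i : Fin K), ν.gap p i ^ 2 * pulls h p i ≤ 2 * a ∧
    (i ∈ ν.subpar ε → ν.gap p i ^ 2 * (samples h Finset.univ i - M) ≤ 50 * a)

theorem measurableSet_pullBounds (ν : Instance M K) (ε a : ℝ) (t : ℕ) :
    MeasurableSet {h : History M K t | PullBounds ν ε a h} := by
  have : {h : History M K t | PullBounds ν ε a h} = ⋂ p, ⋂ i,
      ({h | ν.gap p i ^ 2 * pulls h p i ≤ 2 * a} ∩
        {h | i ∈ ν.subpar ε → ν.gap p i ^ 2 * (samples h Finset.univ i - M) ≤ 50 * a}) := by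
    ext h
    simp [PullBounds]
  rw [this]
  refine MeasurableSet.iInter fun p => MeasurableSet.iInter fun i => MeasurableSet.inter ?_ ?_
  · have := measurable_pulls (M := M) (K := K) (t := t) p i
    exact measurableSet_le (by fun_prop) measurable_const
  · have := measurable_samples (M := M) (K := K) (t := t) Finset.univ i
    by_cases hi : i ∈ ν.subpar ε
    · simp only [hi, true_imp_iff]
      exact measurableSet_le (by fun_prop) measurable_const
    · simp [hi]

theorem samples_snoc_le {t : ℕ} (h : History M K t) (x : Fin M → Fin K × ℝ) (i : Fin K) :
    samples (Fin.snoc h x : History M K (t + 1)) Finset.univ i ≤ samples h Finset.univ i + M := by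
  simp only [samples, pulls_snoc, Finset.sum_add_distrib, add_le_add_iff_left]
  refine (Finset.sum_le_card_nsmul _ _ 1 fun q _ => ?_).trans (by simp)
  split_ifs <;> simp

/-- A count that grows belongs to an arm just pulled, whose count before the round is controlled by
optimism; other counts carry over. The increment costs a factor 2 for a single player, and at most M
for all players, whence the −M in `PullBounds`. -/
theorem pullBounds_snoc {ν : Instance M K} {ε : ℝ} {T : ℕ} (hν : ν.IsDissimilar ε)
    (hL : 1 ≤ 5 * Real.log T) {t : ℕ} {h : History M K t}
    (hc : Concentrated ν (Real.log T) h) (hb : PullBounds ν ε (3328 * Real.log T) h)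
    {x : Fin M → Fin K × ℝ} (hx : ∀ p i, ucb T ε h p i ≤ ucb T ε h p (x p).1) :
    PullBounds ν ε (3328 * Real.log T) (Fin.snoc h x : History M K (t + 1)) := by
  refine fun p i => ⟨?_, fun hi => ?_⟩
  · rw [pulls_snoc]
    by_cases hp : (x p).1 = i
    · subst hp
      have h1 := sq_gap_mul_nBar_le hν hL hc (hx p)
      have h2 : ((pulls h p (x p).1 + 1 : ℕ) : ℝ) ≤ 2 * nBar h p (x p).1 := by
        have : pulls h p (x p).1 + 1 ≤ 2 * nBar h p (x p).1 := by unfold nBar; omega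
        exact_mod_cast this
      rw [if_pos rfl]
      nlinarith [sq_nonneg (ν.gap p (x p).1)]
    · simpa [hp] using (hb p i).1
  · by_cases hq : ∃ q, (x q).1 = i
    · obtain ⟨q, rfl⟩ := hq
      refine le_trans (mul_le_mul_of_nonneg_left ?_ (sq_nonneg _))
        (sq_gap_mul_samples_le hν hL hc (hx q) hi p)
      rw [sub_le_iff_le_add]
      exact_mod_cast samples_snoc_le h x _
    · push Not at hq
      have he : samples (Fin.snoc h x : History M K (t + 1)) Finset.univ i
          = samples h Finset.univ i :=
        Finset.sum_congr rfl fun q _ => by simp [pulls_snoc, hq q]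
      rw [he]
      exact (hb p i).2 hi

/-- The bounds can break in a round only if concentration fails before it, so the failure
probabilities add up over the rounds. -/
theorem measure_not_pullBounds_le {ν : Instance M K} {ε : ℝ} {T : ℕ} (hν : ν.IsDissimilar ε)
    (hL : 1 ≤ 5 * Real.log T) {A : Algorithm M K} (hA : A.IsRobustAgg T ε) {t : ℕ} (ht : t ≤ T) :
    historyLaw ν A t {h | ¬ PullBounds ν ε (3328 * Real.log T) h} ≤
      (t * (M * (K * (4 * (M * T)))) : ℕ) *
        ENNReal.ofReal (Real.exp (-(10 * Real.log T))) := by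
  set e := ENNReal.ofReal (Real.exp (-(10 * Real.log T)))
  have hlog : 0 ≤ Real.log T := by linarith
  induction t with
  | zero =>
    have : ∀ h : History M K 0, PullBounds ν ε (3328 * Real.log T) h := fun h p i => by
      have h1 : 0 ≤ ν.gap p i ^ 2 * M := by positivity
      refine ⟨by simp [pulls, hlog], fun _ => ?_⟩
      simp only [samples, pulls, Finset.univ_eq_empty, Finset.filter_empty, Finset.card_empty,
        Finset.sum_const_zero, Nat.cast_zero]
      linarith
    simp [this]
  | succ t ih =>
    have hms : MeasurableSet {h : History M K (t + 1) | ¬ PullBounds ν ε (3328 * Real.log T) h} :=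
      (measurableSet_pullBounds ν ε _ (t + 1)).compl
    rw [historyLaw, Measure.map_apply (measurable_snoc t) hms]
    set ρ := historyLaw ν A t ⊗ₘ (rewardKernel ν ∘ₖ A.policy t) with hρ
    set B : Set (History M K t) := {h | ¬ PullBounds ν ε (3328 * Real.log T) h} ∪
      {h | ¬ Concentrated ν (Real.log T) h} with hB
    have hle : ρ ((fun x : History M K t × (Fin M → Fin K × ℝ) =>
        (Fin.snoc x.1 x.2 : History M K (t + 1))) ⁻¹'
          {h | ¬ PullBounds ν ε (3328 * Real.log T) h}) ≤ ρ (Prod.fst ⁻¹' B) := by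
      refine measure_mono_ae ?_
      filter_upwards [ae_ucb_le ν A (Nat.lt_of_succ_le ht) hA] with x hx hxb
      by_contra hxB
      have hxB' : ¬ (¬ PullBounds ν ε (3328 * Real.log T) x.1 ∨
        ¬ Concentrated ν (Real.log T) x.1) := hxB
      push Not at hxB'
      exact hxb (pullBounds_snoc hν hL hxB'.2 hxB'.1 hx)
    have hfst : ρ (Prod.fst ⁻¹' B) ≤ historyLaw ν A t B := by
      -- Measurability of B is not needed: a measurable superset of equal measure is passed to the
      -- first marginal.
      obtain ⟨S, hBS, hS, hSe⟩ := exists_measurable_superset (historyLaw ν A t) B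
      rw [← hSe, ← Measure.fst_compProd (historyLaw ν A t) (rewardKernel ν ∘ₖ A.policy t),
        Measure.fst_apply hS]
      exact measure_mono (Set.preimage_mono hBS)
    refine hle.trans (hfst.trans ((measure_union_le _ _).trans ?_))
    refine (add_le_add (ih (by omega)) (measure_not_concentrated_le ν A hlog t)).trans ?_
    rw [← add_mul, ← Nat.cast_add]
    gcongr
    rw [add_mul, one_mul]
    gcongr
    omega

end Invariant

/-! ### From pull bounds to regret. -/

section Regret

theorem sum_sqrt_le_sqrt_card_mul_sum {ι : Type*} (s : Finset ι) {f : ι → ℝ} (hf : ∀ i, 0 ≤ f i) :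
    ∑ i ∈ s, √(f i) ≤ √(s.card * ∑ i ∈ s, f i) := by
  refine Real.le_sqrt_of_sq_le ((sq_sum_le_card_mul_sum_sq).trans (le_of_eq ?_))
  simp only [Real.sq_sqrt (hf _)]

/-- The collective regret of a history. -/
noncomputable def regret (ν : Instance M K) {t : ℕ} (h : History M K t) : ℝ :=
  ∑ p, ∑ i, ν.gap p i * pulls h p i

theorem regret_le (ν : Instance M K) {t : ℕ} (h : History M K t) : regret ν h ≤ M * t := by
  calc regret ν h ≤ ∑ p : Fin M, ∑ i, (pulls h p i : ℝ) :=
        Finset.sum_le_sum fun p _ => Finset.sum_le_sum fun i _ =>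
          mul_le_of_le_one_left (Nat.cast_nonneg _) (gap_le_one ν p i)
    _ = M * t := by simp [← Nat.cast_sum, sum_pulls]

theorem card_compl_subpar_pos {ν : Instance M K} {ε : ℝ} (hν : ν.IsDissimilar ε) (hK : 0 < K)
    (p : Fin M) : 0 < ((ν.subpar ε)ᶜ).card := by
  obtain ⟨i, hi⟩ := exists_gap_eq_zero ν hK p
  exact Finset.card_pos.2 ⟨i, Finset.mem_compl.2 (notMem_subpar_of_gap_eq_zero hν hi)⟩

theorem sum_compl_subpar_le {ν : Instance M K} {ε a : ℝ} (hν : ν.IsDissimilar ε) (hK : 0 < K)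
    (ha : 0 ≤ a) {t : ℕ} {h : History M K t} (hb : PullBounds ν ε a h) (p : Fin M) :
    ∑ i ∈ (ν.subpar ε)ᶜ, ν.gap p i * pulls h p i ≤
      2 * √a * √((((ν.subpar ε)ᶜ).card - 1) * t) := by
  have hpos := card_compl_subpar_pos hν hK p
  -- Every optimal arm is non-subpar. If there is only one non-subpar arm, it is optimal for p and
  -- costs nothing; otherwise the cardinality is at most twice itself minus 1.
  obtain h1 | h2 : ((ν.subpar ε)ᶜ).card = 1 ∨ 2 ≤ ((ν.subpar ε)ᶜ).card := by omega
  · obtain ⟨j, hj⟩ := Finset.card_eq_one.1 h1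
    obtain ⟨i, hi⟩ := exists_gap_eq_zero ν hK p
    have hmem := Finset.mem_compl.2 (notMem_subpar_of_gap_eq_zero hν hi)
    rw [hj, Finset.mem_singleton] at hmem
    subst hmem
    rw [hj]
    simp [hi]
  · have hterm : ∀ i, ν.gap p i * pulls h p i ≤ √(2 * a) * √(pulls h p i : ℝ) := fun i => by
      rw [← Real.sqrt_mul (by positivity)]
      refine Real.le_sqrt_of_sq_le ?_
      calc (ν.gap p i * pulls h p i) ^ 2 = ν.gap p i ^ 2 * pulls h p i * pulls h p i := by ring
        _ ≤ 2 * a * pulls h p i := mul_le_mul_of_nonneg_right (hb p i).1 (Nat.cast_nonneg _)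
    have hsum : ∑ i ∈ (ν.subpar ε)ᶜ, (pulls h p i : ℝ) ≤ t := by
      have hall : ∑ i, (pulls h p i : ℝ) = t := by exact_mod_cast sum_pulls h p
      rw [← hall]
      exact Finset.sum_le_sum_of_subset_of_nonneg (Finset.subset_univ _)
        fun _ _ _ => Nat.cast_nonneg _
    have hcard : (((ν.subpar ε)ᶜ).card : ℝ) ≤ 2 * (((ν.subpar ε)ᶜ).card - 1) := by
      have : (2 : ℝ) ≤ ((ν.subpar ε)ᶜ).card := by exact_mod_cast h2
      linarith
    calc ∑ i ∈ (ν.subpar ε)ᶜ, ν.gap p i * pulls h p i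
        ≤ √(2 * a) * ∑ i ∈ (ν.subpar ε)ᶜ, √(pulls h p i : ℝ) := by
          rw [Finset.mul_sum]
          exact Finset.sum_le_sum fun i _ => hterm i
      _ ≤ √(2 * a) * √(2 * (((ν.subpar ε)ᶜ).card - 1) * t) := by
          refine mul_le_mul_of_nonneg_left ?_ (Real.sqrt_nonneg _)
          refine (sum_sqrt_le_sqrt_card_mul_sum _ fun i => Nat.cast_nonneg _).trans
            (Real.sqrt_le_sqrt ?_)
          exact mul_le_mul hcard hsum (Finset.sum_nonneg fun _ _ => Nat.cast_nonneg _)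
            ((Nat.cast_nonneg _).trans hcard)
      _ = 2 * √a * √((((ν.subpar ε)ᶜ).card - 1) * t) := by
          rw [mul_assoc 2, Real.sqrt_mul (by norm_num : (0 : ℝ) ≤ 2),
            Real.sqrt_mul (by norm_num : (0 : ℝ) ≤ 2)]
          have := Real.mul_self_sqrt (by norm_num : (0 : ℝ) ≤ 2)
          linear_combination (√a * √((((ν.subpar ε)ᶜ).card - 1) * t)) * this

theorem sum_gap_mul_pulls_le {ν : Instance M K} {ε a : ℝ} (ha : 0 ≤ a) {t : ℕ}
    {h : History M K t} (hb : PullBounds ν ε a h) {i : Fin K} (hi : i ∈ ν.subpar ε) :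
    ∑ p, ν.gap p i * pulls h p i ≤ 2 * M + 10 * √a * √(samples h Finset.univ i : ℝ) := by
  set N : ℝ := ((samples h Finset.univ i : ℕ) : ℝ) with hN
  have hNs : ∑ p, (pulls h p i : ℝ) = N := by simp [hN, samples]
  have hN0 : 0 ≤ N := Nat.cast_nonneg _
  have hM0 : (0 : ℝ) ≤ M := Nat.cast_nonneg _
  have hR : 0 ≤ 10 * √a * √N := by positivity
  -- Above 2M one has N − M ≥ N/2, so gap² · N ≤ 100a for every player; below it, gaps at most 1
  -- suffice.
  rcases le_or_gt N (2 * M) with hle | hlt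
  · have : ∑ p, ν.gap p i * pulls h p i ≤ N := by
      rw [← hNs]
      exact Finset.sum_le_sum fun p _ =>
        mul_le_of_le_one_left (Nat.cast_nonneg _) (gap_le_one ν p i)
    linarith
  · have hNpos : 0 < N := by linarith
    have hg : ∀ p, ν.gap p i ≤ 10 * √a / √N := fun p => by
      have h1 := (hb p i).2 hi
      rw [← hN] at h1
      rw [le_div_iff₀ (Real.sqrt_pos.2 hNpos)]
      refine le_of_sq_le_sq ?_ (by positivity)
      rw [mul_pow, mul_pow, Real.sq_sqrt hN0, Real.sq_sqrt ha]
      nlinarith [sq_nonneg (ν.gap p i)]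
    calc ∑ p, ν.gap p i * pulls h p i ≤ ∑ p, 10 * √a / √N * pulls h p i :=
          Finset.sum_le_sum fun p _ => mul_le_mul_of_nonneg_right (hg p) (Nat.cast_nonneg _)
      _ = 10 * √a * √N := by
          rw [← Finset.mul_sum, hNs, div_mul_eq_mul_div, mul_div_assoc, Real.div_sqrt]
      _ ≤ 2 * M + 10 * √a * √N := by linarith

theorem regret_le_of_pullBounds {ν : Instance M K} {ε a : ℝ} (hν : ν.IsDissimilar ε)
    (hK : 0 < K) (ha : 0 ≤ a) {t : ℕ} {h : History M K t} (hb : PullBounds ν ε a h) :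
    regret ν h ≤ 10 * √a * √((ν.subpar ε).card * M * t)
      + 2 * √a * (M * √((((ν.subpar ε)ᶜ).card - 1) * t)) + 2 * (M * (ν.subpar ε).card) := by
  have hsplit : regret ν h = ∑ i ∈ ν.subpar ε, ∑ p, ν.gap p i * pulls h p i
      + ∑ p, ∑ i ∈ (ν.subpar ε)ᶜ, ν.gap p i * pulls h p i := by
    rw [Finset.sum_comm, ← Finset.sum_add_distrib]
    exact Finset.sum_congr rfl fun p _ => (Finset.sum_add_sum_compl _ _).symm
  have h1 : ∑ p, ∑ i ∈ (ν.subpar ε)ᶜ, ν.gap p i * pulls h p i ≤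
      2 * √a * (M * √((((ν.subpar ε)ᶜ).card - 1) * t)) := by
    refine (Finset.sum_le_card_nsmul _ _ _ fun p _ =>
      sum_compl_subpar_le hν hK ha hb p).trans (le_of_eq ?_)
    simp only [Finset.card_univ, Fintype.card_fin, nsmul_eq_mul]
    ring
  have htot : ∑ i ∈ ν.subpar ε, (samples h Finset.univ i : ℝ) ≤ M * t := by
    calc ∑ i ∈ ν.subpar ε, (samples h Finset.univ i : ℝ)
        ≤ ∑ i, (samples h Finset.univ i : ℝ) :=
          Finset.sum_le_sum_of_subset_of_nonneg (Finset.subset_univ _)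
            fun _ _ _ => Nat.cast_nonneg _
      _ = M * t := by
          have : ∑ i, samples h Finset.univ i = M * t := by
            simp only [samples]
            rw [Finset.sum_comm]
            simp [sum_pulls]
          exact_mod_cast this
  have h2 : ∑ i ∈ ν.subpar ε, ∑ p, ν.gap p i * pulls h p i ≤
      10 * √a * √((ν.subpar ε).card * M * t) + 2 * (M * (ν.subpar ε).card) := by
    calc ∑ i ∈ ν.subpar ε, ∑ p, ν.gap p i * pulls h p i
        ≤ ∑ i ∈ ν.subpar ε, (2 * M + 10 * √a * √(samples h Finset.univ i : ℝ)) :=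
          Finset.sum_le_sum fun i hi => sum_gap_mul_pulls_le ha hb hi
      _ = 10 * √a * ∑ i ∈ ν.subpar ε, √(samples h Finset.univ i : ℝ)
            + 2 * (M * (ν.subpar ε).card) := by
          rw [Finset.sum_add_distrib, Finset.mul_sum, Finset.sum_const, nsmul_eq_mul]
          ring
      _ ≤ _ := by
          gcongr
          refine (sum_sqrt_le_sqrt_card_mul_sum _ fun i => Nat.cast_nonneg _).trans
            (Real.sqrt_le_sqrt ?_)
          rw [mul_assoc]
          exact mul_le_mul_of_nonneg_left htot (Nat.cast_nonneg _)
  rw [hsplit]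
  linarith

theorem integrable_pulls (ν : Instance M K) (A : Algorithm M K) (t : ℕ) (p : Fin M) (i : Fin K) :
    Integrable (fun h => (pulls h p i : ℝ)) (historyLaw ν A t) := by
  have := measurable_pulls (M := M) (K := K) (t := t) p i
  refine Integrable.of_bound (by fun_prop) (t : ℝ) (Filter.Eventually.of_forall fun h => ?_)
  rw [Real.norm_of_nonneg (Nat.cast_nonneg _)]
  exact_mod_cast pulls_le h p i

theorem integrable_regret (ν : Instance M K) (A : Algorithm M K) (t : ℕ) :
    Integrable (fun h => regret ν h) (historyLaw ν A t) :=
  integrable_finsetSum _ fun p _ => integrable_finsetSum _ fun i _ =>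
    (integrable_pulls ν A t p i).const_mul _

theorem expectedRegret_eq_integral (ν : Instance M K) (A : Algorithm M K) (t : ℕ) :
    expectedRegret ν A t = ∫ h, regret ν h ∂(historyLaw ν A t) := by
  unfold expectedRegret regret
  rw [integral_finsetSum _ fun p _ => integrable_finsetSum _ fun i _ =>
    (integrable_pulls ν A t p i).const_mul _]
  refine Finset.sum_congr rfl fun p _ => ?_
  rw [integral_finsetSum _ fun i _ => (integrable_pulls ν A t p i).const_mul _]
  exact Finset.sum_congr rfl fun i _ => (integral_const_mul _ _).symm

theorem expectedRegret_le_add_measureReal (ν : Instance M K) (A : Algorithm M K) (t : ℕ) {B : ℝ}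
    (hB : 0 ≤ B) {S : Set (History M K t)} (hS : MeasurableSet S)
    (h : ∀ h ∈ S, regret ν h ≤ B) :
    expectedRegret ν A t ≤ B + M * t * (historyLaw ν A t).real Sᶜ := by
  rw [expectedRegret_eq_integral]
  have hi : Integrable (Sᶜ.indicator fun _ => (M * t : ℝ)) (historyLaw ν A t) :=
    (integrable_const _).indicator hS.compl
  calc ∫ x, regret ν x ∂(historyLaw ν A t)
      ≤ ∫ x, (B + Sᶜ.indicator (fun _ => (M * t : ℝ)) x) ∂(historyLaw ν A t) := by
        refine integral_mono (integrable_regret ν A t) ((integrable_const _).add hi) fun x => ?_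
        by_cases hx : x ∈ S
        · simpa [hx] using h x hx
        · have := regret_le ν x
          simp only [Set.mem_compl_iff, hx, not_false_eq_true, Set.indicator_of_mem]
          linarith
    _ = B + M * t * (historyLaw ν A t).real Sᶜ := by
        rw [integral_add (integrable_const _) hi, integral_indicator_const _ hS.compl]
        simp [mul_comm]

theorem mul_measureReal_not_pullBounds_le_one {ν : Instance M K} {ε : ℝ} {T : ℕ}
    (hν : ν.IsDissimilar ε) (hT : 2 ≤ T) (hM : M ≤ T) (hK : K ≤ T)
    (hL : 1 ≤ 5 * Real.log T) {A : Algorithm M K} (hA : A.IsRobustAgg T ε) :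
    M * T * (historyLaw ν A T).real {h | ¬ PullBounds ν ε (3328 * Real.log T) h} ≤ 1 := by
  have hT0 : (0 : ℝ) < T := by exact_mod_cast (by omega : 0 < T)
  have hexp : Real.exp (-(10 * Real.log T)) = ((T : ℝ) ^ 10)⁻¹ := by
    rw [Real.exp_neg, show (10 : ℝ) * Real.log T = (10 : ℕ) * Real.log T by norm_num,
      Real.exp_nat_mul, Real.exp_log hT0]
  have h1 : (historyLaw ν A T).real {h | ¬ PullBounds ν ε (3328 * Real.log T) h} ≤
      (T * (M * (K * (4 * (M * T)))) : ℕ) * ((T : ℝ) ^ 10)⁻¹ := by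
    refine ENNReal.toReal_le_of_le_ofReal (by positivity) ?_
    rw [ENNReal.ofReal_mul (Nat.cast_nonneg _), ENNReal.ofReal_natCast, ← hexp]
    exact measure_not_pullBounds_le hν hL hA le_rfl
  -- Uses M, K ≤ T and 4 ≤ T²; the product is even at most T⁹.
  have hn : M * T * (T * (M * (K * (4 * (M * T))))) ≤ T ^ 10 := by
    calc M * T * (T * (M * (K * (4 * (M * T))))) ≤ T * T * (T * (T * (T * (T ^ 2 * (T * T))))) := by
          gcongr
          nlinarith
      _ = T ^ 9 := by ring
      _ ≤ T ^ 10 := Nat.pow_le_pow_right (by omega) (by norm_num)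
  calc M * T * (historyLaw ν A T).real {h | ¬ PullBounds ν ε (3328 * Real.log T) h}
      ≤ M * T * ((T * (M * (K * (4 * (M * T)))) : ℕ) * ((T : ℝ) ^ 10)⁻¹) := by gcongr
    _ = ((M * T * (T * (M * (K * (4 * (M * T))))) : ℕ) : ℝ) * ((T : ℝ) ^ 10)⁻¹ := by
        push_cast; ring
    _ ≤ ((T ^ 10 : ℕ) : ℝ) * ((T : ℝ) ^ 10)⁻¹ := by gcongr
    _ = 1 := by push_cast; exact mul_inv_cancel₀ (by positivity)

theorem expectedRegret_eq_zero_of_subsingleton (ν : Instance M 1) (A : Algorithm M 1) (t : ℕ) :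
    expectedRegret ν A t = 0 := by
  refine Finset.sum_eq_zero fun p _ => Finset.sum_eq_zero fun i _ => ?_
  obtain ⟨j, hj⟩ := exists_gap_eq_zero ν one_pos p
  rw [Subsingleton.elim i j, hj, zero_mul]

end Regret

end MPMAB

/-! ### Assembly of the regret bound. -/

theorem theorem2 :
    ∃ (C : ℝ) (k : ℕ), 0 < C ∧
      ∀ (M K T : ℕ), 0 < M → 0 < K → max M K < T →
      ∀ (ε : ℝ) (ν : MPMAB.Instance M K), ν.IsDissimilar ε →
      ∀ A : MPMAB.Algorithm M K, A.IsRobustAgg T ε →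
        MPMAB.expectedRegret ν A T ≤
          C * Real.log T ^ k *
            (Real.sqrt ((ν.subpar ε).card * M * T)
              + M * Real.sqrt ((((ν.subpar ε)ᶜ).card - 1) * T)
              + M * (ν.subpar ε).card) := by
  refine ⟨1160, 1, by norm_num, fun M K T hM hK hT ε ν hν A hA => ?_⟩
  have hMT : M < T := (le_max_left M K).trans_lt hT
  have hKT : K < T := (le_max_right M K).trans_lt hT
  have hT2 : (2 : ℝ) ≤ T := by exact_mod_cast (by omega : 2 ≤ T)
  have hL : 1 / 2 ≤ Real.log T := by
    have := Real.log_le_log (by norm_num) hT2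
    linarith [Real.log_two_gt_d9]
  have hM1 : (1 : ℝ) ≤ M := by exact_mod_cast hM
  rw [pow_one]
  set S₁ := √((ν.subpar ε).card * M * T : ℝ)
  set S₂ := M * √((((ν.subpar ε)ᶜ).card - 1) * T : ℝ)
  set S₃ : ℝ := M * (ν.subpar ε).card
  have hS₁ : 0 ≤ S₁ := Real.sqrt_nonneg _
  have hS₂ : 0 ≤ S₂ := mul_nonneg (Nat.cast_nonneg _) (Real.sqrt_nonneg _)
  have hS₃ : 0 ≤ S₃ := by positivity
  -- With a single arm the right-hand side is 0 and cannot absorb the failure term, but the regret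
  -- is 0 too.
  by_cases hK1 : K = 1
  · subst hK1
    rw [MPMAB.expectedRegret_eq_zero_of_subsingleton]
    have : 0 ≤ Real.log T := by linarith
    positivity
  -- For K ≥ 2 either a subpar arm exists or at least two arms are non-subpar; this absorbs the
  -- failure term 1.
  have hone : 1 ≤ S₂ + S₃ := by
    rcases Nat.eq_zero_or_pos (ν.subpar ε).card with h0 | h0
    · have hc : (1 : ℝ) ≤ ((ν.subpar ε)ᶜ).card - 1 := by
        have : 2 ≤ ((ν.subpar ε)ᶜ).card := by
          rw [Finset.card_compl, h0, Fintype.card_fin]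
          omega
        have : (2 : ℝ) ≤ ((ν.subpar ε)ᶜ).card := by exact_mod_cast this
        linarith
      have : 1 ≤ S₂ := one_le_mul_of_one_le_of_one_le hM1 (Real.one_le_sqrt.2 (by nlinarith))
      linarith
    · have : 1 ≤ S₃ := one_le_mul_of_one_le_of_one_le hM1 (by exact_mod_cast h0)
      linarith
  set a := 3328 * Real.log T with ha
  have ha0 : 0 ≤ a := by linarith
  -- Since ln T ≥ 1/2, 3328 ln T ≤ (100 ln T)². The leading term is then 1000 ln T · S₁, and 1160
  -- covers all the others.
  have hsa : √a ≤ 100 * Real.log T := Real.sqrt_le_iff.2 ⟨by linarith, by nlinarith⟩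
  have hsa0 := Real.sqrt_nonneg a
  have hreg := MPMAB.expectedRegret_le_add_measureReal ν A T
    (B := 10 * √a * S₁ + 2 * √a * S₂ + 2 * S₃) (by positivity)
    (MPMAB.measurableSet_pullBounds ν ε a T)
    fun h hh => MPMAB.regret_le_of_pullBounds hν hK ha0 hh
  have hbad := MPMAB.mul_measureReal_not_pullBounds_le_one hν (by omega) hMT.le hKT.le
    (by linarith) hA
  have hreg' := hreg.trans (add_le_add_right hbad _)
  have e1 : √a * S₁ ≤ 100 * Real.log T * S₁ := mul_le_mul_of_nonneg_right hsa hS₁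
  have e2 : √a * S₂ ≤ 100 * Real.log T * S₂ := mul_le_mul_of_nonneg_right hsa hS₂
  have e3 : 1 / 2 * (S₂ + S₃) ≤ Real.log T * (S₂ + S₃) :=
    mul_le_mul_of_nonneg_right hL (by linarith)
  have e4 : 1 / 2 * S₃ ≤ Real.log T * S₃ := mul_le_mul_of_nonneg_right hL hS₃
  have e5 : 0 ≤ Real.log T * S₁ := mul_nonneg (by linarith) hS₁
  have e6 : 0 ≤ Real.log T * S₂ := mul_nonneg (by linarith) hS₂
  linarith
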